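/- Let $\varphi_0, \varphi_1, \dots$ be a standard effective enumeration of the unary partial computable functions on $\mathbb{N}$ and let $\mathcal{K} = \{ e \in \mathbb{N} : \varphi_e(e)\downarrow \}$. For $n \in \mathbb{N}$, a recursively enumerable set $A \subseteq \mathbb{N}$ is called $n$-$d$-complete if there is a computable map $f$ from $\mathbb{N}$ to the finite subsets of $\mathbb{N}$ (finite sets being coded by natural numbers through a standard effective bijection) such that for all $e \in \mathbb{N}$ $$ e \in \mathcal{K} \iff \exists z \in f(e)\ [z \in A] \qquad\text{and}\qquad |f(e)| \leq n. $$ Proposition. For all $i, j \in \mathbb{N}$ with $i < j$ there is a recursively enumerable set $A \subseteq \mathbb{N}$ that is $j$-$d$-complete but not $i$-$d$-complete. -/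

import Mathlib

/-- The set of (codes of) programs that halt on their own code: `e ∈ K` iff `φ_e(e)↓`, where `φ_e`
is the unary partial recursive function computed by the `e`-th program. -/
def haltingSet : Set ℕ :=
  {e | ((Denumerable.ofNat Nat.Partrec.Code e).eval e).Dom}

/-- `A` is `n`-`d`-complete via `f`: the map `f` from `ℕ` to the finite subsets of `ℕ` is computable
(with respect to the standard bijection of the finite subsets of `ℕ` with `ℕ`),
`e ∈ K` iff some `z ∈ f e` lies in `A`, and every `f e` has at most `n` elements. -/
def IsNDCompleteVia (n : ℕ) (A : Set ℕ) (f : ℕ → Finset ℕ) : Prop :=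
  Computable f ∧ (∀ e, e ∈ haltingSet ↔ ∃ z ∈ f e, z ∈ A) ∧ ∀ e, (f e).card ≤ n

/-- A (recursively enumerable) set `A` is `n`-`d`-complete if it is so via some `f`.
Recursive enumerability of `A` is stated separately where the notion is used. -/
def IsNDComplete (n : ℕ) (A : Set ℕ) : Prop :=
  ∃ f : ℕ → Finset ℕ, IsNDCompleteVia n A f

namespace BoundedDisjunctive

open Encodable Denumerable Nat.Partrec

/-! A finite-injury argument. Cut `ℕ` into blocks of `i + 1` consecutive numbers and put one element
of block `e` into `A` exactly when `e` enters the halting set: sending `e` to its block makes `A`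
`(i + 1)`-`d`-complete. The freedom to choose that element serves to diagonalise.

An r.e. set `B` of witnesses is built alongside. If `A` were `i`-`d`-complete, composing with a
many-one reduction of `B` to the halting set would reduce `B` to `A` by lists of length at most `i`.
Requirement `c` defeats the `c`-th program as such a reduction: once the program outputs a list `D`
disjoint from `A` on the current witness, the witness enters `B` and `D` is restrained from `A`.

A list of length `i` cannot cover a block, so the strongest (least) requirement meeting the block
can always be respected (`exists_allowed`). A requirement is therefore injured only in blocks met by
stronger restraints. Once those have settled, they meet finitely many blocks, each receiving at most
one element, so every requirement acts finitely often (`actions_eventually_const`). A program that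
did reduce `B` to `A` would force yet another action (`not_disjunctive_reduction`). -/

/-! ### Computability of the coding of finite sets. -/

theorem primrec_raise' : Primrec₂ raise' := by
  -- The fold carries the output in reverse together with the next offset.
  have h : ∀ (l : List ℕ) (n : ℕ) (acc : List ℕ),
      (l.foldl (fun (p : List ℕ × ℕ) m => ((m + p.2) :: p.1, m + p.2 + 1)) (acc, n)).1.reverse
        = acc.reverse ++ raise' l n := by
    intro l
    induction l with
    | nil => intro n acc; simp [raise']
    | cons m l ih => intro n acc; simp [raise', ih]
  have hstep : Primrec₂ fun (_ : List ℕ × ℕ) (q : (List ℕ × ℕ) × ℕ) =>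
      ((q.2 + q.1.2) :: q.1.1, q.2 + q.1.2 + 1) := by
    have hs : Primrec fun x : (List ℕ × ℕ) × ((List ℕ × ℕ) × ℕ) => x.2.2 + x.2.1.2 :=
      Primrec.nat_add.comp (Primrec.snd.comp Primrec.snd)
        (Primrec.snd.comp (Primrec.fst.comp Primrec.snd))
    exact Primrec.pair
      (Primrec.list_cons.comp hs (Primrec.fst.comp (Primrec.fst.comp Primrec.snd)))
      (Primrec.succ.comp hs)
  have := Primrec.list_reverse.comp (Primrec.fst.comp
    (Primrec.list_foldl (α := List ℕ × ℕ) Primrec.fst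
      (Primrec.pair (Primrec.const []) Primrec.snd) hstep))
  exact this.of_eq fun p => by simpa using h p.1 p.2 []

theorem ofNat_finset_val (n : ℕ) :
    (ofNat (Finset ℕ) n).val = raise' (ofNat (List ℕ) n) 0 := by
  have h : ofNat (Finset ℕ) n =
      Finset.map (eqv ℕ).symm.toEmbedding (raise'Finset (ofNat (List ℕ) n) 0) :=
    ofNat_of_decode rfl
  rw [h]
  have e : (eqv ℕ).symm.toEmbedding = Function.Embedding.refl ℕ := by
    ext x; simp [eqv]
  rw [e, Finset.map_refl]
  rfl

/-- A list enumerating a finite set of naturals. -/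
def finsetList (s : Finset ℕ) : List ℕ :=
  raise' (ofNat (List ℕ) (@encode (Finset ℕ) Denumerable.finset.toEncodable s)) 0

theorem finsetList_val (s : Finset ℕ) : s.val = finsetList s := by
  rw [finsetList, ← ofNat_finset_val, @ofNat_encode (Finset ℕ) Denumerable.finset s]

theorem mem_finsetList {s : Finset ℕ} {z : ℕ} : z ∈ finsetList s ↔ z ∈ s := by
  rw [← Finset.mem_val, finsetList_val, Multiset.mem_coe]

theorem length_finsetList (s : Finset ℕ) : (finsetList s).length = s.card := by
  rw [Finset.card_def, finsetList_val, Multiset.coe_card]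

theorem primrec_finsetList : Primrec finsetList :=
  primrec_raise'.comp ((Primrec.ofNat (List ℕ)).comp Primrec.encode) (Primrec.const 0)

theorem raise'_zeros (b n : ℕ) : raise' (List.replicate n 0) b = List.range' b n := by
  induction n generalizing b with
  | zero => rfl
  | succ n ih => simp [List.replicate_succ, List.range'_succ, raise', ih]

/-- A finite set is coded by its least element followed by the gaps, each less one, so a block is
coded by its left end followed by `i` zeros. -/
theorem computable_Ico (i : ℕ) :
    Computable fun e : ℕ => Finset.Ico (e * (i + 1)) (e * (i + 1) + (i + 1)) := by
  have h : Primrec fun e : ℕ =>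
      ofNat (Finset ℕ) (encode ((e * (i + 1)) :: List.replicate i 0)) :=
    (Primrec.ofNat (Finset ℕ)).comp (Primrec.encode.comp
      (Primrec.list_cons.comp (Primrec.nat_mul.comp Primrec.id (Primrec.const (i + 1)))
        (Primrec.const _)))
  refine h.to_comp.of_eq fun e => ?_
  ext z
  rw [← Finset.mem_val, ofNat_finset_val, ofNat_encode, raise', raise'_zeros]
  simp only [Multiset.mem_coe, List.mem_cons, List.mem_range'_1, Finset.mem_Ico]
  omega

/-! ### R.e. predicates and many-one completeness of the halting set. -/

theorem REPred.exists_nat {α : Type*} [Primcodable α] {p : α → ℕ → Prop}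
    (hp : PrimrecRel p) : REPred fun a => ∃ n, p a n := by
  classical
  have h : Partrec fun a => Nat.rfindOpt fun n => if p a n then some () else none :=
    Partrec.rfindOpt (Primrec.ite (c := fun x : α × ℕ => p x.1 x.2) hp
      (Primrec.const (some ())) (Primrec.const none)).to_comp
  refine (Partrec.dom_re h).of_eq fun a => ?_
  simp [Nat.rfindOpt_dom]

/-- By currying, `x` yields a program that ignores its input and halts iff `p x`; in particular this
decides whether it halts on its own code. -/
theorem REPred.exists_reduction {p : ℕ → Prop} (hp : REPred p) :
    ∃ t : ℕ → ℕ, Computable t ∧ ∀ x, p x ↔ t x ∈ haltingSet := by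
  have h1 : Partrec fun n : ℕ => (Part.assert (p n.unpair.1) fun _ => Part.some ()).map
      fun _ => (0 : ℕ) :=
    Partrec.map (Partrec.comp hp (Computable.fst.comp Computable.unpair)) (Computable.const 0).to₂
  obtain ⟨c, hc⟩ := Code.exists_code.1 (Partrec.nat_iff.1 h1)
  refine ⟨fun x => encode (Code.curry c x),
    (Primrec.encode.comp (Code.primrec₂_curry.comp (Primrec.const c) Primrec.id)).to_comp,
    fun x => ?_⟩
  rw [haltingSet, Set.mem_ofPred_eq, ofNat_encode, Code.eval_curry, hc]
  simp [Part.assert]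

/-! ### The stagewise construction with restraints. -/

section Construction

open scoped Classical

/-- The restraint of requirement `c` recorded in the log `L`. -/
def restraint (L : List (ℕ × List ℕ)) (c : ℕ) : List ℕ :=
  L.foldr (fun p r => if p.1 = c then p.2 else r) []

/-- The number of entries of requirement `c` in the log `L`. -/
def actions (L : List (ℕ × List ℕ)) (c : ℕ) : ℕ :=
  L.foldr (fun p n => if p.1 = c then n + 1 else n) 0

/-- The restraint of `c` meets the `e`-th block of length `i + 1`. -/
def Touches (i : ℕ) (L : List (ℕ × List ℕ)) (e c : ℕ) : Prop :=
  ∃ z ∈ restraint L c, z / (i + 1) = e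

/-- Every requirement that forbids `a` is preceded by one that meets the `e`-th block. -/
def Allowed (i : ℕ) (L : List (ℕ × List ℕ)) (e a : ℕ) : Prop :=
  ∀ p ∈ L, a ∈ restraint L p.1 → ∃ q ∈ L, q.1 < p.1 ∧ Touches i L e q.1

/-- An element of the `e`-th block, allowed by the restraints if possible. -/
noncomputable def pick (i : ℕ) (L : List (ℕ × List ℕ)) (e : ℕ) : ℕ :=
  e * (i + 1) + (List.range (i + 1)).findIdx fun k => decide (Allowed i L e (e * (i + 1) + k))

/-- A finite approximation of the set under construction, with the log of the requirements. -/
abbrev State : Type := List ℕ × List (ℕ × List ℕ)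

/-- Puts an element of the `e`-th block into the set if `e` enters the halting set by time `t`. -/
noncomputable def codeStep (i e t : ℕ) (S : State) : State :=
  if (Code.evaln t (ofNat Code e) e).isSome = true ∧ ¬ ∃ z ∈ S.1, z / (i + 1) = e then
    (pick i S.2 e :: S.1, S.2)
  else S

/-- Requirement `c` has not acted yet, or its restraint has been violated. -/
def Ready (S : State) (c : ℕ) : Prop :=
  actions S.2 c = 0 ∨ ∃ z ∈ restraint S.2 c, z ∈ S.1

/-- Lets requirement `c` act with the restraint `D`, if that is possible. -/
noncomputable def act (i c : ℕ) (S : State) (D : List ℕ) : State :=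
  if Ready S c ∧ D.length ≤ i ∧ ¬ ∃ z ∈ D, z ∈ S.1 then (S.1, (c, D) :: S.2) else S

/-- Lets requirement `c` act at time `t`, with the output of the `c`-th program on its next
witness as restraint. -/
noncomputable def reqStep (i c t : ℕ) (S : State) : State :=
  (Code.evaln t (ofNat Code c) (Nat.pair c (actions S.2 c))).elim S
    fun v => act i c S (ofNat (List ℕ) v)

/-- The state reached after `s` stages. -/
noncomputable def state (i : ℕ) : ℕ → State
  | 0 => ([], [])
  | s + 1 => reqStep i s.unpair.1 s.unpair.2 (codeStep i s.unpair.1 s.unpair.2 (state i s))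

/-! ### Primitive recursiveness of the construction. -/

theorem primrec_restraint : Primrec₂ restraint := by
  refine Primrec.list_foldr (α := List (ℕ × List ℕ) × ℕ) Primrec.fst (Primrec.const ([] : List ℕ))
    (h := fun x y => if y.1.1 = x.2 then y.1.2 else y.2) ?_
  exact Primrec.ite
    (Primrec.eq.comp (Primrec.fst.comp (Primrec.fst.comp Primrec.snd))
      (Primrec.snd.comp Primrec.fst))
    (Primrec.snd.comp (Primrec.fst.comp Primrec.snd)) (Primrec.snd.comp Primrec.snd)

theorem primrec_actions : Primrec₂ actions := by
  refine Primrec.list_foldr (α := List (ℕ × List ℕ) × ℕ) Primrec.fst (Primrec.const 0)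
    (h := fun x y => if y.1.1 = x.2 then y.2 + 1 else y.2) ?_
  exact Primrec.ite
    (Primrec.eq.comp (Primrec.fst.comp (Primrec.fst.comp Primrec.snd))
      (Primrec.snd.comp Primrec.fst))
    (Primrec.succ.comp (Primrec.snd.comp Primrec.snd)) (Primrec.snd.comp Primrec.snd)

theorem primrecRel_mem_list : PrimrecRel fun (l : List ℕ) (a : ℕ) => a ∈ l :=
  (PrimrecRel.exists_mem_list (R := fun x a : ℕ => x = a) Primrec.eq).of_eq fun l a => by simp

theorem primrecRel_meets : PrimrecRel fun l m : List ℕ => ∃ z ∈ l, z ∈ m :=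
  PrimrecRel.exists_mem_list (R := fun (z : ℕ) (m : List ℕ) => z ∈ m)
    (primrecRel_mem_list.comp Primrec.snd Primrec.fst)

theorem primrecRel_meets_block (i : ℕ) :
    PrimrecRel fun (l : List ℕ) (e : ℕ) => ∃ z ∈ l, z / (i + 1) = e :=
  PrimrecRel.exists_mem_list (R := fun z e : ℕ => z / (i + 1) = e)
    (Primrec.eq.comp (Primrec.nat_div.comp Primrec.fst (Primrec.const (i + 1))) Primrec.snd)

theorem primrecPred_touches (i : ℕ) {α : Type*} [Primcodable α] {L : α → List (ℕ × List ℕ)}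
    {e c : α → ℕ} (hL : Primrec L) (he : Primrec e) (hc : Primrec c) :
    PrimrecPred fun x => Touches i (L x) (e x) (c x) :=
  (primrecRel_meets_block i).comp (primrec_restraint.comp hL hc) he

theorem primrecPred_allowed (i : ℕ) {α : Type*} [Primcodable α] {L : α → List (ℕ × List ℕ)}
    {e a : α → ℕ} (hL : Primrec L) (he : Primrec e) (ha : Primrec a) :
    PrimrecPred fun x => Allowed i (L x) (e x) (a x) := by
  have h1 : PrimrecRel fun (q : ℕ × List ℕ) (y : (List (ℕ × List ℕ) × ℕ) × ℕ) =>
      q.1 < y.2 ∧ Touches i y.1.1 y.1.2 q.1 :=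
    PrimrecPred.and
      (Primrec.nat_lt.comp (Primrec.fst.comp Primrec.fst) (Primrec.snd.comp Primrec.snd))
      (primrecPred_touches i (Primrec.fst.comp (Primrec.fst.comp Primrec.snd))
        (Primrec.snd.comp (Primrec.fst.comp Primrec.snd)) (Primrec.fst.comp Primrec.fst))
  have h2 : PrimrecRel fun (p : ℕ × List ℕ) (y : (List (ℕ × List ℕ) × ℕ) × ℕ) =>
      ¬ y.2 ∈ restraint y.1.1 p.1 ∨ ∃ q ∈ y.1.1, q.1 < p.1 ∧ Touches i y.1.1 y.1.2 q.1 := by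
    refine PrimrecPred.or (PrimrecPred.not ?_) ?_
    · exact primrecRel_mem_list.comp
        (primrec_restraint.comp (Primrec.fst.comp (Primrec.fst.comp Primrec.snd))
          (Primrec.fst.comp Primrec.fst)) (Primrec.snd.comp Primrec.snd)
    · exact h1.exists_mem_list.comp (Primrec.fst.comp (Primrec.fst.comp Primrec.snd))
        (Primrec.pair (Primrec.fst.comp Primrec.snd) (Primrec.fst.comp Primrec.fst))
  refine (h2.forall_mem_list.comp hL (Primrec.pair (Primrec.pair hL he) ha)).of_eq fun x => ?_
  simp only [Allowed, imp_iff_not_or]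

theorem primrec_pick (i : ℕ) : Primrec₂ (pick i) := by
  have hb : Primrec fun x : List (ℕ × List ℕ) × ℕ => x.2 * (i + 1) :=
    Primrec.nat_mul.comp Primrec.snd (Primrec.const _)
  refine Primrec.nat_add.comp hb (Primrec.list_findIdx (Primrec.const _) ?_)
  exact (primrecPred_allowed i (Primrec.fst.comp Primrec.fst) (Primrec.snd.comp Primrec.fst)
    (Primrec.nat_add.comp (hb.comp Primrec.fst) Primrec.snd)).decide

theorem primrec_evaln {α : Type*} [Primcodable α] {t e n : α → ℕ} (ht : Primrec t)
    (he : Primrec e) (hn : Primrec n) :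
    Primrec fun x => Code.evaln (t x) (ofNat Code (e x)) (n x) :=
  Code.primrec_evaln.comp
    (Primrec.pair (Primrec.pair ht ((Primrec.ofNat Code).comp he)) hn)

theorem primrec_codeStep (i : ℕ) {α : Type*} [Primcodable α] {e t : α → ℕ} {S : α → State}
    (he : Primrec e) (ht : Primrec t) (hS : Primrec S) :
    Primrec fun x => codeStep i (e x) (t x) (S x) := by
  refine Primrec.ite (PrimrecPred.and ?_ (PrimrecPred.not ?_)) ?_ hS
  · exact Primrec.eq.comp (Primrec.option_isSome.comp (primrec_evaln ht he he))
      (Primrec.const true)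
  · exact (primrecRel_meets_block i).comp (Primrec.fst.comp hS) he
  · exact Primrec.pair (Primrec.list_cons.comp
      ((primrec_pick i).comp (Primrec.snd.comp hS) he) (Primrec.fst.comp hS)) (Primrec.snd.comp hS)

theorem primrec_act (i : ℕ) {α : Type*} [Primcodable α] {c : α → ℕ} {S : α → State}
    {D : α → List ℕ} (hc : Primrec c) (hS : Primrec S) (hD : Primrec D) :
    Primrec fun x => act i (c x) (S x) (D x) := by
  refine Primrec.ite (PrimrecPred.and (PrimrecPred.or ?_ ?_)
    (PrimrecPred.and ?_ (PrimrecPred.not ?_))) ?_ hS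
  · exact Primrec.eq.comp (primrec_actions.comp (Primrec.snd.comp hS) hc) (Primrec.const 0)
  · exact primrecRel_meets.comp (primrec_restraint.comp (Primrec.snd.comp hS) hc)
      (Primrec.fst.comp hS)
  · exact Primrec.nat_le.comp (Primrec.list_length.comp hD) (Primrec.const i)
  · exact primrecRel_meets.comp hD (Primrec.fst.comp hS)
  · exact Primrec.pair (Primrec.fst.comp hS)
      (Primrec.list_cons.comp (Primrec.pair hc hD) (Primrec.snd.comp hS))

theorem primrec_reqStep (i : ℕ) {α : Type*} [Primcodable α] {c t : α → ℕ} {S : α → State}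
    (hc : Primrec c) (ht : Primrec t) (hS : Primrec S) :
    Primrec fun x => reqStep i (c x) (t x) (S x) := by
  have h := Primrec.option_casesOn
    (primrec_evaln ht hc (Primrec₂.natPair.comp hc (primrec_actions.comp (Primrec.snd.comp hS) hc)))
    hS (g := fun x v => act i (c x) (S x) (ofNat (List ℕ) v))
    (primrec_act i (hc.comp Primrec.fst) (hS.comp Primrec.fst)
      ((Primrec.ofNat (List ℕ)).comp Primrec.snd))
  refine h.of_eq fun x => ?_
  rw [reqStep]
  cases Code.evaln (t x) (ofNat Code (c x)) (Nat.pair (c x) (actions (S x).2 (c x))) <;> rfl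

theorem primrec_state (i : ℕ) : Primrec (state i) := by
  have hu : Primrec fun x : ℕ × State => x.1.unpair := Primrec.unpair.comp Primrec.fst
  have h := Primrec.nat_rec₁ (α := State) (([], []) : State)
    (f := fun s S => reqStep i s.unpair.1 s.unpair.2 (codeStep i s.unpair.1 s.unpair.2 S))
    (primrec_reqStep i (Primrec.fst.comp hu) (Primrec.snd.comp hu)
      (primrec_codeStep i (Primrec.fst.comp hu) (Primrec.snd.comp hu) Primrec.snd))
  refine h.of_eq fun s => ?_
  induction s with
  | zero => rfl
  | succ s ih => rw [state, ← ih]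

/-- The constructed set. -/
def limitSet (i : ℕ) : Set ℕ := {z | ∃ s, z ∈ (state i s).1}

/-- The set of the witnesses used by the requirements. -/
def witnessSet (i : ℕ) : Set ℕ := {x | ∃ s, x.unpair.2 < actions (state i s).2 x.unpair.1}

theorem rePred_limitSet (i : ℕ) : REPred fun z => z ∈ limitSet i :=
  REPred.exists_nat (p := fun z s => z ∈ (state i s).1)
    (primrecRel_mem_list.comp (Primrec.fst.comp ((primrec_state i).comp Primrec.snd)) Primrec.fst)

theorem rePred_witnessSet (i : ℕ) : REPred fun x => x ∈ witnessSet i :=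
  REPred.exists_nat (p := fun (x s : ℕ) => x.unpair.2 < actions (state i s).2 x.unpair.1)
    (Primrec.nat_lt.comp (Primrec.snd.comp (Primrec.unpair.comp Primrec.fst))
      (primrec_actions.comp (Primrec.snd.comp ((primrec_state i).comp Primrec.snd))
        (Primrec.fst.comp (Primrec.unpair.comp Primrec.fst))))

/-! ### Choice of elements and behaviour of the log. -/

theorem restraint_cons (p : ℕ × List ℕ) (L : List (ℕ × List ℕ)) (c : ℕ) :
    restraint (p :: L) c = if p.1 = c then p.2 else restraint L c := rfl

theorem actions_cons (p : ℕ × List ℕ) (L : List (ℕ × List ℕ)) (c : ℕ) :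
    actions (p :: L) c = if p.1 = c then actions L c + 1 else actions L c := rfl

theorem exists_mem_of_mem_restraint {L : List (ℕ × List ℕ)} {c z : ℕ} (h : z ∈ restraint L c) :
    ∃ p ∈ L, p.1 = c := by
  induction L with
  | nil => simp [restraint] at h
  | cons p L ih =>
    by_cases hp : p.1 = c
    · exact ⟨p, by simp, hp⟩
    · rw [restraint_cons, if_neg hp] at h
      obtain ⟨q, hq, hqc⟩ := ih h
      exact ⟨q, by simp [hq], hqc⟩

/-- Take the least `c` whose restraint meets the block. By pigeonhole some element of the block
escapes it, and any requirement forbidding that element comes after `c`. -/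
theorem exists_allowed {i : ℕ} {L : List (ℕ × List ℕ)} (hL : ∀ c, (restraint L c).length ≤ i)
    (e : ℕ) : ∃ k < i + 1, Allowed i L e (e * (i + 1) + k) := by
  by_cases ht : ∃ c, Touches i L e c
  · have hc := Nat.find_spec ht
    have hmin := fun c => @Nat.find_min' _ _ ht c
    set c := Nat.find ht
    obtain ⟨k, hk, hkc⟩ : ∃ k < i + 1, e * (i + 1) + k ∉ restraint L c := by
      by_contra! h
      have hsub : (Finset.range (i + 1)).image (e * (i + 1) + ·) ⊆ (restraint L c).toFinset := by
        intro z hz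
        obtain ⟨k, hk, rfl⟩ := Finset.mem_image.1 hz
        exact List.mem_toFinset.2 (h k (Finset.mem_range.1 hk))
      have h1 := Finset.card_le_card hsub
      rw [Finset.card_image_of_injective _ (add_right_injective _), Finset.card_range] at h1
      have := List.toFinset_card_le (restraint L c)
      have := hL c
      omega
    refine ⟨k, hk, fun p _ hp => ?_⟩
    obtain ⟨z, hz, hze⟩ := id hc
    obtain ⟨q, hq, hqc⟩ := exists_mem_of_mem_restraint hz
    refine ⟨q, hq, ?_, hqc ▸ hc⟩
    have hle : c ≤ p.1 := hmin _ ⟨_, hp, by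
      rw [mul_comm, Nat.mul_add_div (by omega), Nat.div_eq_of_lt hk, add_zero]⟩
    rcases hle.lt_or_eq with h | h
    · omega
    · exact absurd (h ▸ hp) hkc
  · refine ⟨0, by omega, fun p _ hp => (ht ⟨p.1, _, hp, ?_⟩).elim⟩
    simp

theorem pick_spec {i : ℕ} {L : List (ℕ × List ℕ)} (hL : ∀ c, (restraint L c).length ≤ i)
    (e : ℕ) : pick i L e / (i + 1) = e ∧ Allowed i L e (pick i L e) := by
  obtain ⟨k, hk, hka⟩ := exists_allowed hL e
  have hlt : (List.range (i + 1)).findIdx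
      (fun k => decide (Allowed i L e (e * (i + 1) + k))) < (List.range (i + 1)).length :=
    List.findIdx_lt_length_of_exists ⟨k, List.mem_range.2 hk, by simpa using hka⟩
  have h := List.findIdx_getElem (w := hlt)
  rw [List.getElem_range, decide_eq_true_iff] at h
  rw [List.length_range] at hlt
  refine ⟨?_, h⟩
  rw [pick, add_comm, Nat.add_mul_div_right _ _ (by omega), Nat.div_eq_of_lt hlt, zero_add]

theorem codeStep_snd (i e t : ℕ) (S : State) : (codeStep i e t S).2 = S.2 := by
  rw [codeStep]; split_ifs <;> rfl

theorem reqStep_cases (i c t : ℕ) (S : State) : reqStep i c t S = S ∨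
    ∃ D, reqStep i c t S = (S.1, (c, D) :: S.2) ∧ Ready S c ∧ D.length ≤ i ∧
      (¬ ∃ z ∈ D, z ∈ S.1) ∧
      encode D ∈ (ofNat Code c).eval (Nat.pair c (actions S.2 c)) := by
  rw [reqStep]
  cases h : Code.evaln t (ofNat Code c) (Nat.pair c (actions S.2 c)) with
  | none => exact Or.inl rfl
  | some v =>
    by_cases hr : Ready S c ∧ (ofNat (List ℕ) v).length ≤ i ∧ ¬ ∃ z ∈ ofNat (List ℕ) v, z ∈ S.1
    · refine Or.inr ⟨ofNat (List ℕ) v, if_pos hr, hr.1, hr.2.1, hr.2.2, ?_⟩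
      rw [encode_ofNat]
      exact Code.evaln_sound h
    · exact Or.inl (if_neg hr)

theorem reqStep_fst (i c t : ℕ) (S : State) : (reqStep i c t S).1 = S.1 := by
  rcases reqStep_cases i c t S with h | ⟨D, h, -⟩ <;> rw [h]

theorem state_succ_fst (i s : ℕ) :
    (state i (s + 1)).1 = (codeStep i s.unpair.1 s.unpair.2 (state i s)).1 := by
  rw [state, reqStep_fst]

theorem length_restraint_state_le (i s c : ℕ) : (restraint (state i s).2 c).length ≤ i := by
  induction s with
  | zero => exact Nat.zero_le i
  | succ s ih =>
    rw [state]
    rcases reqStep_cases i s.unpair.1 s.unpair.2 (codeStep i s.unpair.1 s.unpair.2 (state i s))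
      with h | ⟨D, h, -, hD, -⟩
    · rwa [h, codeStep_snd]
    · rw [h, codeStep_snd, restraint_cons]
      split_ifs
      exacts [hD, ih]

/-- The witness is indexed by the number of actions before acting, hence the `- 1` for the restraint
now in force. -/
theorem encode_restraint_mem_eval (i s c : ℕ) (h : actions (state i s).2 c ≠ 0) :
    encode (restraint (state i s).2 c) ∈
      (ofNat Code c).eval (Nat.pair c (actions (state i s).2 c - 1)) := by
  induction s with
  | zero => exact (h rfl).elim
  | succ s ih =>
    rw [state] at h ⊢
    rcases reqStep_cases i s.unpair.1 s.unpair.2 (codeStep i s.unpair.1 s.unpair.2 (state i s))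
      with h' | ⟨D, h', -, -, -, hD⟩
    · rw [h', codeStep_snd] at h ⊢
      exact ih h
    · rw [h', codeStep_snd] at h ⊢
      rw [codeStep_snd] at hD
      rw [actions_cons] at h
      rw [restraint_cons, actions_cons]
      split_ifs at h ⊢ with hc
      · subst hc
        simpa using hD
      · exact ih h

theorem state_fst_mono (i : ℕ) {s t : ℕ} (h : s ≤ t) : (state i s).1 ⊆ (state i t).1 := by
  induction t, h using Nat.le_induction with
  | base => exact List.Subset.refl _
  | succ t _ ih =>
    refine List.Subset.trans ih ?_
    rw [state_succ_fst, codeStep]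
    split_ifs
    exacts [List.subset_cons_self _ _, List.Subset.refl _]

theorem actions_state_succ (i s c : ℕ) :
    actions (state i s).2 c < actions (state i (s + 1)).2 c ∨
      (actions (state i (s + 1)).2 c = actions (state i s).2 c ∧
        restraint (state i (s + 1)).2 c = restraint (state i s).2 c) := by
  rw [state]
  rcases reqStep_cases i s.unpair.1 s.unpair.2 (codeStep i s.unpair.1 s.unpair.2 (state i s))
    with h' | ⟨D, h', -⟩
  · rw [h', codeStep_snd]; simp
  · rw [h', codeStep_snd, actions_cons, restraint_cons]
    split_ifs <;> simp

theorem actions_state_mono (i c : ℕ) : Monotone fun s => actions (state i s).2 c :=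
  monotone_nat_of_le_succ fun s => by
    rcases actions_state_succ i s c with h | h <;> omega

theorem restraint_eq_of_actions_eq {i c s t : ℕ} (h : s ≤ t)
    (ha : actions (state i t).2 c = actions (state i s).2 c) :
    restraint (state i t).2 c = restraint (state i s).2 c := by
  induction t, h using Nat.le_induction with
  | base => rfl
  | succ t hst ih =>
    have h1 := actions_state_mono i c hst
    have h2 := actions_state_mono i c (Nat.le_succ t)
    dsimp only at h1 h2
    rcases actions_state_succ i t c with h | ⟨h, h'⟩
    · simp only [Nat.succ_eq_add_one] at h2; omega
    · rw [h', ih (by omega)]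

/-! ### Finite injury. -/

/-- Bounds the number of future actions of `c`, if the requirements before `c` only restrain
elements of the blocks in `E`. -/
noncomputable def potential (i : ℕ) (E : Finset ℕ) (S : State) (c : ℕ) : ℕ :=
  actions S.2 c + (E.filter fun e => ∀ z ∈ S.1, z / (i + 1) ≠ e).card +
    if Ready S c then 1 else 0

/-- An action costs one unit of readiness: the new restraint is disjoint from the set, so the
requirement stops being ready. -/
theorem potential_reqStep_le (i : ℕ) (E : Finset ℕ) (S : State) (u t c : ℕ) :
    potential i E (reqStep i u t S) c ≤ potential i E S c := by
  rcases reqStep_cases i u t S with h | ⟨D, h, hr, -, hD, -⟩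
  · rw [h]
  · rw [h]
    by_cases hc : u = c
    · subst hc
      have hn : ¬ Ready (S.1, (u, D) :: S.2) u := by
        simpa [Ready, actions_cons, restraint_cons] using hD
      rw [potential, potential, if_pos hr, if_neg hn, actions_cons, if_pos rfl]
      dsimp only
      omega
    · have hrc : Ready (S.1, (u, D) :: S.2) c ↔ Ready S c := by
        simp [Ready, actions_cons, restraint_cons, hc]
      simp [potential, hrc, actions_cons, hc]

theorem potential_codeStep_le {i : ℕ} {E : Finset ℕ} {S : State} {c : ℕ}
    (hL : ∀ c, (restraint S.2 c).length ≤ i)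
    (hE : ∀ c' < c, ∀ z ∈ restraint S.2 c', z / (i + 1) ∈ E) (e t : ℕ) :
    potential i E (codeStep i e t S) c ≤ potential i E S c := by
  rw [codeStep]
  split_ifs with h
  · obtain ⟨hdiv, hall⟩ := pick_spec hL e
    have hsub : E.filter (fun u => ∀ z ∈ pick i S.2 e :: S.1, z / (i + 1) ≠ u) ⊆
        E.filter fun u => ∀ z ∈ S.1, z / (i + 1) ≠ u := fun u hu => by
      simp only [Finset.mem_filter, List.mem_cons] at hu ⊢
      exact ⟨hu.1, fun z hz => hu.2 z (Or.inr hz)⟩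
    have hle := Finset.card_le_card hsub
    -- An injury may make `c` ready again, but only in a block of `E` that was still empty; filling
    -- it pays for the gain.
    by_cases hin : pick i S.2 e ∈ restraint S.2 c
    · obtain ⟨p, hp, rfl⟩ := exists_mem_of_mem_restraint hin
      obtain ⟨q, -, hqp, z, hz, hze⟩ := hall p hp hin
      have hlt := Finset.card_lt_card (Finset.ssubset_iff_subset_ne.2 ⟨hsub, fun heq => by
        have he : e ∈ E.filter fun u => ∀ z ∈ S.1, z / (i + 1) ≠ u :=
          Finset.mem_filter.2 ⟨hze ▸ hE _ hqp z hz, fun z hz hze => h.2 ⟨z, hz, hze⟩⟩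
        rw [← heq, Finset.mem_filter] at he
        exact he.2 _ List.mem_cons_self hdiv⟩)
      simp only [potential]
      split_ifs <;> omega
    · have hr : Ready (pick i S.2 e :: S.1, S.2) c → Ready S c := by
        rintro (h0 | ⟨z, hz, hzA⟩)
        · exact Or.inl h0
        · rcases List.mem_cons.1 hzA with rfl | hzA
          · exact (hin hz).elim
          · exact Or.inr ⟨z, hz, hzA⟩
      simp only [potential]
      split_ifs with h1 h2
      · omega
      · exact (h2 (hr h1)).elim
      · omega
      · omega
  · exact le_rfl

theorem actions_eventually_const (i c : ℕ) :
    ∃ s₀, ∀ s ≥ s₀, actions (state i s).2 c = actions (state i s₀).2 c := by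
  induction c using Nat.strong_induction_on with
  | _ c ih =>
    choose! f hf using ih
    -- From here on the stronger restraints are frozen, so one finite `E` contains all the blocks
    -- they meet.
    set s₀ := (Finset.range c).sup f
    have hs₀ : ∀ c' < c, ∀ s ≥ s₀, restraint (state i s).2 c' = restraint (state i s₀).2 c' := by
      intro c' hc' s hs
      have h0 : f c' ≤ s₀ := Finset.le_sup (Finset.mem_range.2 hc')
      rw [restraint_eq_of_actions_eq (h0.trans hs) (hf c' hc' s (h0.trans hs)),
        restraint_eq_of_actions_eq h0 (hf c' hc' s₀ h0)]
    set E : Finset ℕ := (Finset.range c).biUnion fun c' =>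
      (restraint (state i s₀).2 c').toFinset.image (· / (i + 1))
    have hE : ∀ s ≥ s₀, ∀ c' < c, ∀ z ∈ restraint (state i s).2 c', z / (i + 1) ∈ E := by
      intro s hs c' hc' z hz
      rw [hs₀ c' hc' s hs] at hz
      exact Finset.mem_biUnion.2 ⟨c', Finset.mem_range.2 hc',
        Finset.mem_image_of_mem _ (List.mem_toFinset.2 hz)⟩
    have hpot : ∀ s ≥ s₀, potential i E (state i s) c ≤ potential i E (state i s₀) c := by
      intro s hs
      induction s, hs using Nat.le_induction with
      | base => exact le_rfl
      | succ s hs ih =>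
        rw [state]
        exact (potential_reqStep_le _ _ _ _ _ _).trans ((potential_codeStep_le
          (fun c => length_restraint_state_le i s c) (hE s hs) _ _).trans ih)
    have hbdd : ∀ s, actions (state i s).2 c ≤ potential i E (state i s₀) c := fun s => by
      have h1 := actions_state_mono i c (le_max_left s s₀)
      have h2 := hpot _ (le_max_right s s₀)
      rw [potential] at h2
      dsimp only at h1
      omega
    obtain ⟨b, N, hN⟩ := converges_of_monotone_of_bounded (actions_state_mono i c) hbdd
    exact ⟨N, fun s hs => (hN s hs).trans (hN N le_rfl).symm⟩

/-! ### Coding the halting set into the blocks. -/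

theorem mem_haltingSet_iff (i e : ℕ) :
    e ∈ haltingSet ↔ ∃ z ∈ limitSet i, z / (i + 1) = e := by
  constructor
  · intro he
    obtain ⟨v, hv⟩ := Part.dom_iff_mem.1 he
    obtain ⟨t, ht⟩ := Code.evaln_complete.1 hv
    have hs : ∃ z ∈ (state i (Nat.pair e t + 1)).1, z / (i + 1) = e := by
      rw [state_succ_fst, Nat.unpair_pair]
      by_cases h : ∃ z ∈ (state i (Nat.pair e t)).1, z / (i + 1) = e
      · rwa [codeStep, if_neg (fun h' => h'.2 h)]
      · rw [codeStep, if_pos ⟨Option.isSome_iff_exists.2 ⟨v, ht⟩, h⟩]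
        exact ⟨_, List.mem_cons_self, (pick_spec (fun c => length_restraint_state_le i _ c) e).1⟩
    obtain ⟨z, hz, hze⟩ := hs
    exact ⟨z, ⟨_, hz⟩, hze⟩
  · rintro ⟨z, ⟨s, hz⟩, rfl⟩
    induction s with
    | zero => exact (List.not_mem_nil hz).elim
    | succ s ih =>
      rw [state_succ_fst, codeStep] at hz
      split_ifs at hz with h
      · rcases List.mem_cons.1 hz with rfl | hz
        · rw [(pick_spec (fun c => length_restraint_state_le i s c) _).1]
          obtain ⟨v, hv⟩ := Option.isSome_iff_exists.1 h.1
          exact Part.dom_iff_mem.2 ⟨v, Code.evaln_sound hv⟩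
        · exact ih hz
      · exact ih hz

theorem isNDComplete_limitSet (i : ℕ) : IsNDComplete (i + 1) (limitSet i) := by
  refine ⟨_, computable_Ico i, fun e => ?_, fun e => by simp⟩
  rw [mem_haltingSet_iff i e]
  refine exists_congr fun z => ?_
  rw [and_comm, Finset.mem_Ico, Nat.div_eq_iff (by omega)]
  have : (e + 1) * (i + 1) = e * (i + 1) + (i + 1) := by ring
  constructor <;> rintro ⟨h, hA⟩ <;> refine ⟨?_, hA⟩ <;> omega

/-! ### Diagonalisation against reductions of length at most `i`. -/

theorem mem_witnessSet_pair_iff {i c s₀ n : ℕ}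
    (h : ∀ s ≥ s₀, actions (state i s).2 c = actions (state i s₀).2 c) :
    Nat.pair c n ∈ witnessSet i ↔ n < actions (state i s₀).2 c := by
  simp only [witnessSet, Set.mem_ofPred_eq, Nat.unpair_pair]
  refine ⟨fun ⟨s, hs⟩ => ?_, fun hn => ⟨s₀, hn⟩⟩
  have h1 := actions_state_mono i c (le_max_left s s₀)
  have h2 := h _ (le_max_right s s₀)
  dsimp only at h1
  omega

theorem not_disjunctive_reduction (i : ℕ) (g : ℕ → List ℕ) (hg : Computable g)
    (hlen : ∀ x, (g x).length ≤ i) :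
    ¬ ∀ x, x ∈ witnessSet i ↔ ∃ z ∈ g x, z ∈ limitSet i := by
  intro hred
  obtain ⟨c, hc⟩ := Code.exists_code.1 (Partrec.nat_iff.1
    (Computable.encode.comp hg : Computable fun x => encode (g x)))
  have hev : ∀ x, (ofNat Code (encode c)).eval x = Part.some (encode (g x)) := fun x => by
    rw [ofNat_encode, hc]; rfl
  set d := encode c
  obtain ⟨s₀, hs₀⟩ := actions_eventually_const i d
  set n := actions (state i s₀).2 d
  have hmem := fun m => mem_witnessSet_pair_iff (n := m) hs₀
  -- The next witness, of index `n`, never enters `B`, so a correct reduction sends it to a list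
  -- that stays disjoint from `A`.
  have hempty : ∀ s, ¬ ∃ z ∈ g (Nat.pair d n), z ∈ (state i s).1 := by
    rintro s ⟨z, hz, hzs⟩
    exact lt_irrefl _ ((hmem n).1 ((hred _).2 ⟨z, hz, s, hzs⟩))
  -- If `d` has acted, its final restraint is the image of witness `n - 1`, which is in `B`; a
  -- correct reduction makes this restraint meet `A`, and it does so permanently.
  obtain ⟨s₁, hs₁, hready⟩ : ∃ s₁ ≥ s₀, ∀ s ≥ s₁, Ready (state i s) d := by
    by_cases hn : n = 0
    · exact ⟨s₀, le_rfl, fun s hs => Or.inl ((hs₀ s hs).trans hn)⟩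
    · have hr := encode_restraint_mem_eval i s₀ d hn
      rw [hev, Part.mem_some_iff] at hr
      have hr := encode_injective hr
      obtain ⟨z, hz, s, hzs⟩ := (hred (Nat.pair d (n - 1))).1 ((hmem _).2 (by omega))
      refine ⟨max s s₀, le_max_right _ _, fun t ht => Or.inr ⟨z, ?_, ?_⟩⟩
      · have ht : s₀ ≤ t := (le_max_right _ _).trans ht
        rw [restraint_eq_of_actions_eq ht (hs₀ t ht), hr]
        exact hz
      · exact state_fst_mono i ((le_max_left _ _).trans ht) hzs
  obtain ⟨t, ht⟩ := Code.evaln_complete.1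
    (show encode (g (Nat.pair d n)) ∈ (ofNat Code d).eval (Nat.pair d n) by
      rw [hev]; exact Part.mem_some _)
  -- A stage devoted to `d`, with enough time for the computation and late enough for `d` to be
  -- ready: it must act once more.
  set s := Nat.pair d (max t s₁)
  have hs : s₁ ≤ s := (le_max_right _ _).trans (Nat.right_le_pair _ _)
  have hact : state i (s + 1) =
      ((codeStep i d (max t s₁) (state i s)).1, (d, g (Nat.pair d n)) :: (state i s).2) := by
    have hsucc := state_succ_fst i s
    rw [state, Nat.unpair_pair]
    rw [Nat.unpair_pair] at hsucc
    rw [reqStep, codeStep_snd, hs₀ s (hs₁.trans hs), Code.evaln_mono (le_max_left _ _) ht]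
    simp only [Option.elim, ofNat_encode]
    have hne := hempty (s + 1)
    rw [hsucc] at hne
    have hr : Ready (codeStep i d (max t s₁) (state i s)) d := by
      rcases hready s hs with h | ⟨z, hz, hzA⟩
      · exact Or.inl (by rwa [codeStep_snd])
      · refine Or.inr ⟨z, by rwa [codeStep_snd], ?_⟩
        rw [← hsucc]
        exact state_fst_mono i (Nat.le_succ s) hzA
    rw [act, if_pos ⟨hr, hlen _, hne⟩, codeStep_snd]
  have h1 := hs₀ (s + 1) ((hs₁.trans hs).trans (Nat.le_succ s))
  rw [hact, actions_cons, if_pos rfl, hs₀ s (hs₁.trans hs)] at h1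
  omega

/-- Diagonalising against reductions of `B` suffices, since `B` reduces to the halting set by a
single query. -/
theorem not_isNDComplete_limitSet (i : ℕ) : ¬ IsNDComplete i (limitSet i) := by
  rintro ⟨f, hf, hK, hcard⟩
  obtain ⟨t, ht, htB⟩ := REPred.exists_reduction (rePred_witnessSet i)
  refine not_disjunctive_reduction i (fun x => finsetList (f (t x)))
    (primrec_finsetList.to_comp.comp (hf.comp ht))
    (fun x => (length_finsetList _).trans_le (hcard _)) fun x => ?_
  rw [htB, hK]
  simp only [mem_finsetList]

end Construction

end BoundedDisjunctive

open BoundedDisjunctive in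
theorem mainTheorem4 (i j : ℕ) (hij : i < j) :
    ∃ A : Set ℕ, REPred (fun x => x ∈ A) ∧ IsNDComplete j A ∧ ¬ IsNDComplete i A := by
  obtain ⟨f, hf, hK, hcard⟩ := isNDComplete_limitSet i
  exact ⟨limitSet i, rePred_limitSet i, ⟨f, hf, hK, fun e => (hcard e).trans hij⟩,
    not_isNDComplete_limitSet i⟩
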